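/- Let $E$ and $F$ be complex Banach spaces with $F$ reflexive, let $U\subseteq E$ be open, and let $f\colon U\to F$ be holomorphic. Suppose that $f$ is Cohen strongly $2$-summing, i.e. there is a constant $C\ge 0$ such that for all $n\in\mathbb{N}$, $\lambda_1,\dots,\lambda_n\in\mathbb{C}$, $x_1,\dots,x_n\in U$ and $y_1^*,\dots,y_n^*\in F^*$, $$\sum_{i=1}^n|\lambda_i|\,|\langle y_i^*,f(x_i)\rangle|\le C\Big(\sum_{i=1}^n|\lambda_i|^2\Big)^{1/2}\sup_{y^{**}\in B_{F^{**}}}\Big(\sum_{i=1}^n|y^{**}(y_i^*)|^2\Big)^{1/2},$$ where $B_{F^{**}}$ is the closed unit ball of $F^{**}$. Then there exist a complex Hilbert space $H$, a bounded holomorphic mapping $g\colon U\to H$ and a bounded linear operator $T\colon H\to F$ such that $f=T\circ g$ and $T$ is strongly $2$-summing, i.e. there is a constant $C'\ge 0$ such that for all $n\in\mathbb{N}$, $h_1,\dots,h_n\in H$ and $y_1^*,\dots,y_n^*\in F^*$, $$\sum_{i=1}^n|\langle y_i^*,T(h_i)\rangle|\le C'\Big(\sum_{i=1}^n\|h_i\|^2\Big)^{1/2}\sup_{y^{**}\in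 B_{F^{**}}}\Big(\sum_{i=1}^n|y^{**}(y_i^*)|^2\Big)^{1/2}.$$ -/

import Mathlib

universe u v

noncomputable section

namespace CohenSumming

variable {E F : Type*} [NormedAddCommGroup E] [NormedSpace ℂ E]
  [NormedAddCommGroup F] [NormedSpace ℂ F]

/-- A normed space is reflexive when the canonical map into its bidual is onto. -/
def IsReflexive (F : Type*) [NormedAddCommGroup F] [NormedSpace ℂ F] : Prop :=
  Function.Surjective (NormedSpace.inclusionInDoubleDual ℂ F)

/-- `‖y‖_{q,weak} = sup {‖(φ(y₁), …, φ(yₙ))‖_q : φ ∈ B_{F**}}` for `y₁, …, yₙ ∈ F*`. -/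
def weakNorm (q : ENNReal) {n : ℕ} (y : Fin n → StrongDual ℂ F) : ℝ :=
  ⨆ φ : {φ : StrongDual ℂ (StrongDual ℂ F) // ‖φ‖ ≤ 1},
    ‖WithLp.toLp q (fun i => φ.1 (y i))‖

/-- Strongly `p`-summing bounded operators, `T ∈ D_p(E, F)`, for `1 ≤ p ≤ ∞`.
`‖WithLp.toLp p x‖` is `(∑ ‖xᵢ‖ ^ p) ^ (1 / p)` for finite `p` and `max ‖xᵢ‖` for `p = ∞`;
`p.conjExponent` is the conjugate index of `p`. -/
def IsStronglySumming (p : ENNReal) (T : E →L[ℂ] F) : Prop :=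
  ∃ C : ℝ, 0 ≤ C ∧ ∀ (n : ℕ) (x : Fin n → E) (y : Fin n → StrongDual ℂ F),
    ∑ i, ‖y i (T (x i))‖ ≤ C * ‖WithLp.toLp p x‖ * weakNorm p.conjExponent y

/-- `f` restricts on `U` to a Cohen strongly `p`-summing holomorphic mapping,
`f ∈ D_p^{H^∞}(U, F)`, for `1 ≤ p ≤ ∞` and `U` open; values of `f` outside `U` play no role. -/
def IsCohenStronglySumming (p : ENNReal) (U : Set E) (f : E → F) : Prop :=
  DifferentiableOn ℂ f U ∧
  ∃ C : ℝ, 0 ≤ C ∧ ∀ (n : ℕ) (l : Fin n → ℂ) (x : Fin n → E) (y : Fin n → StrongDual ℂ F),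
    (∀ i, x i ∈ U) →
      ∑ i, ‖l i‖ * ‖y i (f (x i))‖ ≤ C * ‖WithLp.toLp p l‖ * weakNorm p.conjExponent y

/-- `g` restricts on the open set `U` to a bounded holomorphic mapping, `g ∈ H^∞(U, F)`. -/
def IsBoundedHolomorphic (U : Set E) (g : E → F) : Prop :=
  DifferentiableOn ℂ g U ∧ Bornology.IsBounded (g '' U)

end CohenSumming

end

namespace CohenSumming

open Metric Filter Topology
open scoped BoundedContinuousFunction

/-! Pietsch domination, then Hilbert space factorization. Hahn–Banach gives a mean `L` on bounded
continuous functions on B_{F**} with |y(f x)|² ≤ C² L(|φ(y)|²); a mean replaces the usual measure,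
so no compactness is needed. The form L(conj φ(y) · φ(z)) makes F* pre-Hilbert, with a dense-range
map j into its completion K. By domination, y ↦ y(f x) is bounded for ‖j ·‖, so it extends to g(x) ∈
K*. The adjoint of j, K* → F** = F, is T, and T(g x) = f x. T is strongly 2-summing since ∑‖j yᵢ‖²
is the mean of ∑|φ(yᵢ)|²; g is holomorphic because it is bounded and holomorphic when tested on the
dense vectors j y. -/

/-! ### Holomorphy from a dense set of test vectors -/

/-- Second-order Taylor estimate for a bounded holomorphic mapping. -/
theorem norm_sub_sub_fderiv_le {E G : Type*} [NormedAddCommGroup E] [NormedSpace ℂ E]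
    [NormedAddCommGroup G] [NormedSpace ℂ G] {f : E → G} {c x : E} {r M : ℝ}
    (hd : DifferentiableOn ℂ f (ball c r)) (hM : ∀ z ∈ ball c r, ‖f z‖ ≤ M) (hx : x ∈ ball c r) :
    ‖fderiv ℂ f c‖ ≤ 2 * M / r ∧
      ‖f x - f c - fderiv ℂ f c (x - c)‖ ≤ 4 * M * (‖x - c‖ / r) ^ 2 := by
  have hr : 0 < r := nonempty_ball.mp ⟨_, hx⟩
  have hc : c ∈ ball c r := mem_ball_self hr
  have hsub : ∀ z ∈ ball c r, ‖f z - f c‖ ≤ 2 * M := fun z hz =>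
    (norm_sub_le _ _).trans (by linarith [hM z hz, hM c hc])
  have h1 : ‖fderiv ℂ f c‖ ≤ 2 * M / r :=
    Complex.norm_fderiv_le_div_of_mapsTo_ball hd
      (fun z hz => by rw [mem_closedBall_iff_norm]; exact hsub z hz) hr
  refine ⟨h1, ?_⟩
  have hfc : HasFDerivAt f (fderiv ℂ f c) c :=
    (hd.differentiableAt (ball_mem_nhds _ hr)).hasFDerivAt
  -- Higher-order Schwarz lemma: f minus its linear part is constant up to o(z - c), and deviates
  -- from its value at c by at most 2M + 2M.
  have key := Complex.dist_le_mul_div_pow_of_mapsTo_ball_of_isLittleO (n := 1) (R₂ := 4 * M)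
    (f := fun z => f z - fderiv ℂ f c (z - c)) (c := c) (z := x) (R₁ := r) ?_ ?_ ?_ hx
  · simpa [dist_eq_norm, sub_right_comm] using key
  · exact hd.sub (by fun_prop)
  · intro z hz
    rw [mem_closedBall_iff_norm]
    have h2 : ‖fderiv ℂ f c (z - c)‖ ≤ 2 * M := by
      have hM0 : 0 ≤ M := (norm_nonneg _).trans (hM c hc)
      calc ‖fderiv ℂ f c (z - c)‖ ≤ ‖fderiv ℂ f c‖ * ‖z - c‖ := ContinuousLinearMap.le_opNorm _ _
        _ ≤ 2 * M / r * r := by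
          gcongr
          exact (mem_ball_iff_norm.mp hz).le
        _ = 2 * M := by field_simp
    have h3 : f z - fderiv ℂ f c (z - c) - (f c - fderiv ℂ f c (c - c))
        = (f z - f c) - fderiv ℂ f c (z - c) := by simp; abel
    rw [h3]
    exact (norm_sub_le _ _).trans (by linarith [hsub z hz])
  · have := hfc.isLittleO.norm_right
    simpa [sub_right_comm] using this

/-- A bounded operator-valued mapping which is holomorphic when tested on the vectors of a
dense range is holomorphic. -/
theorem differentiableOn_of_denseRange {E V H G : Type*} [NormedAddCommGroup E] [NormedSpace ℂ E]
    [AddCommGroup V] [Module ℂ V] [NormedAddCommGroup H] [NormedSpace ℂ H]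
    [NormedAddCommGroup G] [NormedSpace ℂ G] [CompleteSpace G]
    {U : Set E} (hU : IsOpen U) (j : V →ₗ[ℂ] H) (hj : DenseRange j) (g : E → H →L[ℂ] G) {C : ℝ}
    (hC : ∀ x ∈ U, ‖g x‖ ≤ C) (hg : ∀ y, DifferentiableOn ℂ (fun x => g x (j y)) U) :
    DifferentiableOn ℂ g U := by
  intro c hc
  obtain ⟨r, hr, hrU⟩ := Metric.isOpen_iff.mp hU c hc
  have hC0 : 0 ≤ C := (norm_nonneg _).trans (hC c hc)
  have hM : ∀ y, ∀ z ∈ ball c r, ‖g z (j y)‖ ≤ C * ‖j y‖ := fun y z hz =>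
    (g z).le_of_opNorm_le (hC z (hrU hz)) _
  have est := fun y x (hx : x ∈ ball c r) =>
    norm_sub_sub_fderiv_le ((hg y).mono hrU) (hM y) hx
  have hda : ∀ y, DifferentiableAt ℂ (fun x => g x (j y)) c := fun y =>
    (hg y).differentiableAt (hU.mem_nhds hc)
  let ℓ : E → V →ₗ[ℂ] G := fun v =>
    { toFun := fun y => fderiv ℂ (fun x => g x (j y)) c v
      map_add' := fun y z => by
        simp only [map_add]
        rw [fderiv_fun_add (hda y) (hda z)]; rfl
      map_smul' := fun a y => by
        simp only [map_smul]
        rw [fderiv_fun_const_smul (hda y)]; rfl }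
  have hℓ : ∀ v y, ‖ℓ v y‖ ≤ 2 * C / r * ‖v‖ * ‖j y‖ := fun v y => by
    refine (ContinuousLinearMap.le_of_opNorm_le _ (est y c (mem_ball_self hr)).1 v).trans_eq ?_
    ring
  have hext : ∀ v y, (ℓ v).extendOfNorm j (j y) = ℓ v y := fun v y =>
    LinearMap.extendOfNorm_eq hj ⟨_, hℓ v⟩ y
  have hfun : ∀ A B : H →L[ℂ] G, (∀ y, A (j y) = B (j y)) → A = B := fun A B h =>
    ContinuousLinearMap.coeFn_injective (hj.equalizer A.continuous B.continuous (funext h))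
  -- The Cauchy bound is linear in ‖j y‖, so the tested derivatives extend from the range of `j` to
  -- all of H.
  let D : E →L[ℂ] H →L[ℂ] G := LinearMap.mkContinuous
    { toFun := fun v => (ℓ v).extendOfNorm j
      map_add' := fun v w => hfun _ _ fun y => by
        rw [_root_.add_apply, hext, hext, hext]; exact map_add (fderiv ℂ (fun x => g x (j y)) c) v w
      map_smul' := fun a v => hfun _ _ fun y => by
        rw [_root_.smul_apply, hext, hext]; exact map_smul (fderiv ℂ (fun x => g x (j y)) c) a v } (2 * C / r)
    (fun v => LinearMap.opNorm_extendOfNorm_le hj (by positivity) (hℓ v))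
  have hD : ∀ v y, D v (j y) = fderiv ℂ (fun x => g x (j y)) c v := hext
  -- The tested remainders are also O(‖j y‖), so density yields an operator-norm bound.
  have hrem : ∀ x ∈ ball c r, ‖g x - g c - D (x - c)‖ ≤ 4 * C / r ^ 2 * ‖‖x - c‖ ^ 2‖ := by
    intro x hx
    refine ContinuousLinearMap.opNorm_le_bound _ (by positivity) ?_
    refine hj.induction ?_ (isClosed_le (by fun_prop) (by fun_prop))
    rintro _ ⟨y, rfl⟩
    refine (le_of_eq ?_).trans ((est y x hx).2.trans_eq ?_)
    · simp [hD]
    · rw [norm_pow, norm_norm]; field_simp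
  refine DifferentiableAt.differentiableWithinAt (HasFDerivAt.differentiableAt (f' := D) ?_)
  refine HasFDerivAt.of_isLittleO ?_
  have hO : (fun x => g x - g c - D (x - c)) =O[𝓝 c] fun x => ‖x - c‖ ^ 2 :=
    Asymptotics.IsBigO.of_bound _ (Filter.eventually_of_mem (ball_mem_nhds c hr) hrem)
  refine hO.trans_isLittleO ?_
  exact Asymptotics.isLittleO_pow_sub_sub c one_lt_two

/-! ### Means by Hahn–Banach separation -/

/-- A convex cone of bounded functions none of which is uniformly negative is nonnegative under
some mean, i.e. under a positive normalised functional. -/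
theorem exists_mean_nonneg {K : Type*} [TopologicalSpace K] (S : ConvexCone ℝ (K →ᵇ ℝ))
    (h0 : 0 ∈ S) (hS : ∀ s ∈ S, ∀ ε > 0, ∃ k, -ε < s k) :
    ∃ L : StrongDual ℝ (K →ᵇ ℝ), L 1 = 1 ∧ (∀ v, (∀ k, 0 ≤ v k) → 0 ≤ L v) ∧
      ∀ s ∈ S, 0 ≤ L s := by
  let A : Set (K →ᵇ ℝ) := {v | ∃ ε > 0, ∀ k, v k ≤ -ε}
  have hAo : IsOpen A := by
    rw [Metric.isOpen_iff]
    rintro v ⟨ε, hε, hv⟩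
    refine ⟨ε / 2, by positivity, fun w hw => ⟨ε / 2, by positivity, fun k => ?_⟩⟩
    have h1 : dist (w k) (v k) < ε / 2 := (w.dist_coe_le_dist k).trans_lt hw
    rw [Real.dist_eq] at h1
    linarith [hv k, (abs_lt.mp h1).2]
  have hAc : Convex ℝ A := by
    rintro v ⟨ε, hε, hv⟩ w ⟨δ, hδ, hw⟩ a b ha hb hab
    refine ⟨min ε δ, lt_min hε hδ, fun k => ?_⟩
    have h1 : v k ≤ -min ε δ := (hv k).trans (neg_le_neg (min_le_left _ _))
    have h2 : w k ≤ -min ε δ := (hw k).trans (neg_le_neg (min_le_right _ _))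
    calc (a • v + b • w) k = a * v k + b * w k := rfl
      _ ≤ a * (-min ε δ) + b * (-min ε δ) := by gcongr
      _ = -min ε δ := by rw [← add_mul, hab, one_mul]
  have hdisj : Disjoint A (S : Set (K →ᵇ ℝ)) := by
    rw [Set.disjoint_left]
    rintro v ⟨ε, hε, hv⟩ hvS
    obtain ⟨k, hk⟩ := hS v hvS ε hε
    exact absurd (hv k) (not_le.mpr hk)
  obtain ⟨L, u, hLA, hLS⟩ := geometric_hahn_banach_open hAc hAo S.convex hdisj
  have hu : u ≤ 0 := by simpa using hLS 0 h0
  have hneg : ∀ a ∈ A, L a < 0 := fun a ha => (hLA a ha).trans_le hu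
  have h1 : 0 < L 1 := by
    have := hneg (-1) ⟨1, one_pos, fun k => le_rfl⟩
    rw [map_neg] at this
    linarith
  have hcone : ∀ s ∈ S, 0 ≤ L s := by
    intro s hs
    by_contra! hlt
    -- Scaling s by this factor gives `L` the value u - 1 < u.
    have ht : 0 < (1 - u) / (-L s) := div_pos (by linarith) (by linarith)
    have := hLS _ (S.smul_mem ht hs)
    rw [map_smul, smul_eq_mul, div_mul_eq_mul_div, le_div_iff₀ (by linarith)] at this
    nlinarith
  have hpos : ∀ v : K →ᵇ ℝ, (∀ k, 0 ≤ v k) → 0 ≤ L v := by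
    intro v hv
    refine le_of_forall_pos_le_add fun ε hε => ?_
    have := hneg (-v - (ε / L 1) • 1) ⟨ε / L 1, by positivity, fun k => by
      have : (-v - (ε / L 1) • (1 : K →ᵇ ℝ)) k = - v k - ε / L 1 * 1 := rfl
      rw [this]; linarith [hv k]⟩
    rw [map_sub, map_neg, map_smul, smul_eq_mul, div_mul_cancel₀ _ h1.ne'] at this
    linarith
  refine ⟨(L 1)⁻¹ • L, ?_, fun v hv => ?_, fun s hs => ?_⟩
  · simp [h1.ne']
  · exact mul_nonneg (inv_nonneg.mpr h1.le) (hpos v hv)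
  · exact mul_nonneg (inv_nonneg.mpr h1.le) (hcone s hs)

/-! ### The Hilbert space of a mean -/

variable {X : Type*} [NormedAddCommGroup X] [NormedSpace ℂ X]

/-- Evaluation of functionals in the dual unit ball, as a bounded continuous function. -/
noncomputable def evalBall (X : Type*) [NormedAddCommGroup X] [NormedSpace ℂ X] :
    X →ₗ[ℂ] {φ : StrongDual ℂ X // ‖φ‖ ≤ 1} →ᵇ ℂ where
  toFun y := BoundedContinuousFunction.ofNormedAddCommGroup (fun φ => φ.1 y)
    ((ContinuousLinearMap.apply ℂ ℂ y).continuous.comp continuous_subtype_val) ‖y‖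
    (fun φ => φ.1.le_of_opNorm_le φ.2 y |>.trans_eq (one_mul _))
  map_add' y z := by ext φ; exact map_add φ.1 y z
  map_smul' a y := by ext φ; exact map_smul φ.1 a y

@[simp]
theorem evalBall_apply (y : X) (φ : {φ : StrongDual ℂ X // ‖φ‖ ≤ 1}) :
    evalBall X y φ = φ.1 y := rfl

/-- The real part of a bounded complex function. -/
noncomputable def reBounded (K : Type*) [TopologicalSpace K] : (K →ᵇ ℂ) →L[ℝ] K →ᵇ ℝ :=
  Complex.reCLM.compLeftContinuousBounded K

@[simp]
theorem reBounded_apply {K : Type*} [TopologicalSpace K] (w : K →ᵇ ℂ) (k : K) :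
    reBounded K w k = (w k).re := rfl

/-- `y ↦ (φ ↦ ‖φ y‖ ^ 2)` on the dual unit ball. -/
noncomputable def sqEval (y : X) : {φ : StrongDual ℂ X // ‖φ‖ ≤ 1} →ᵇ ℝ :=
  reBounded _ (star (evalBall X y) * evalBall X y)

@[simp]
theorem sqEval_apply (y : X) (φ : {φ : StrongDual ℂ X // ‖φ‖ ≤ 1}) :
    sqEval y φ = ‖φ.1 y‖ ^ 2 := by
  simp [sqEval, Complex.sq_norm, Complex.normSq_apply]

/-- The complex-linear extension of a real functional to bounded complex functions. -/
noncomputable def meanExtend {K : Type*} [TopologicalSpace K] (L : StrongDual ℝ (K →ᵇ ℝ)) :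
    (K →ᵇ ℂ) →ₗ[ℂ] ℂ :=
  Module.Dual.extendRCLike (𝕜 := ℂ) (L.comp (reBounded K)).toLinearMap

theorem meanExtend_apply {K : Type*} [TopologicalSpace K] (L : StrongDual ℝ (K →ᵇ ℝ))
    (w : K →ᵇ ℂ) :
    meanExtend L w = L (reBounded K w) - Complex.I * L (reBounded K (Complex.I • w)) := rfl

/-- The semi-inner product on `X` given by a positive functional `L` on bounded functions on the
dual unit ball. -/
@[reducible]
noncomputable def coreOfMean (L : StrongDual ℝ ({φ : StrongDual ℂ X // ‖φ‖ ≤ 1} →ᵇ ℝ))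
    (hL : ∀ v, (∀ k, 0 ≤ v k) → 0 ≤ L v) : PreInnerProductSpace.Core ℂ X where
  inner y z := meanExtend L (star (evalBall X y) * evalBall X z)
  conj_inner_symm y z := by
    have h : star (evalBall X y) * evalBall X z = star (star (evalBall X z) * evalBall X y) := by
      simp [mul_comm]
    rw [h]
    generalize star (evalBall X z) * evalBall X y = w
    have h1 : reBounded _ (star w) = reBounded _ w := by ext k; simp
    have h2 : reBounded _ (Complex.I • star w) = - reBounded _ (Complex.I • w) := by
      ext k; simp
    simp [meanExtend_apply, h1, h2]
  re_inner_nonneg y := by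
    have : 0 ≤ L (sqEval y) := hL _ fun k => by simp
    simpa [meanExtend_apply, sqEval] using this
  add_left x y z := by simp [add_mul]
  smul_left x y r := by simp

theorem re_coreOfMean_inner_self (L : StrongDual ℝ ({φ : StrongDual ℂ X // ‖φ‖ ≤ 1} →ᵇ ℝ))
    (hL : ∀ v, (∀ k, 0 ≤ v k) → 0 ≤ L v) (y : X) :
    ((coreOfMean L hL).inner y y).re = L (sqEval y) := by
  change (meanExtend L (star (evalBall X y) * evalBall X y)).re = L (sqEval y)
  simp [meanExtend_apply, sqEval]

/-- A semi-inner product on a complex vector space comes from a map into a Hilbert space. -/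
theorem exists_hilbert_of_core {V : Type v} [AddCommGroup V] [Module ℂ V]
    (c : PreInnerProductSpace.Core ℂ V) :
    ∃ (H : Type v) (_ : NormedAddCommGroup H) (_ : InnerProductSpace ℂ H) (_ : CompleteSpace H)
      (j : V →ₗ[ℂ] H), DenseRange j ∧ ∀ y, ‖j y‖ ^ 2 = (c.inner y y).re := by
  let _ : SeminormedAddCommGroup V := @InnerProductSpace.Core.toSeminormedAddCommGroup ℂ V _ _ _ c
  let _ : InnerProductSpace ℂ V := InnerProductSpace.ofCore c
  -- Completion also quotients out null vectors, so definiteness is not needed.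
  refine ⟨UniformSpace.Completion V, inferInstance, inferInstance, inferInstance,
    (UniformSpace.Completion.toComplL : V →L[ℂ] UniformSpace.Completion V).toLinearMap,
    UniformSpace.Completion.denseRange_coe, fun y => ?_⟩
  simp only [ContinuousLinearMap.coe_coe, UniformSpace.Completion.coe_toComplL,
    UniformSpace.Completion.norm_coe]
  exact InnerProductSpace.norm_sq_eq_re_inner (𝕜 := ℂ) y

/-- The dual of a Hilbert space is a Hilbert space. -/
@[reducible]
noncomputable def innerProductSpaceDual (H : Type*) [NormedAddCommGroup H] [InnerProductSpace ℂ H]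
    [CompleteSpace H] : InnerProductSpace ℂ (StrongDual ℂ H) where
  -- The arguments are swapped because `toDual` is conjugate-linear.
  inner a b := inner ℂ ((InnerProductSpace.toDual ℂ H).symm b)
    ((InnerProductSpace.toDual ℂ H).symm a)
  norm_sq_eq_re_inner a := by
    rw [← InnerProductSpace.norm_sq_eq_re_inner, LinearIsometryEquiv.norm_map]
  conj_inner_symm a b := inner_conj_symm _ _
  add_left a b c := by rw [map_add, inner_add_right]
  smul_left a b r := by rw [map_smulₛₗ, inner_smul_right]

/-! ### The weak 2-norm -/

section WeakNorm

variable {F : Type*} [NormedAddCommGroup F] [NormedSpace ℂ F]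

theorem conjExponent_two : ENNReal.conjExponent 2 = 2 :=
  ENNReal.HolderConjugate.conjExponent_eq

theorem sum_norm_sq_le_weakNorm_sq {n : ℕ} (y : Fin n → StrongDual ℂ F)
    (φ : {φ : StrongDual ℂ (StrongDual ℂ F) // ‖φ‖ ≤ 1}) :
    ∑ i, ‖φ.1 (y i)‖ ^ 2 ≤ weakNorm 2 y ^ 2 := by
  have hb : BddAbove (Set.range fun φ : {φ : StrongDual ℂ (StrongDual ℂ F) // ‖φ‖ ≤ 1} =>
      ‖WithLp.toLp 2 (fun i => φ.1 (y i))‖) := by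
    refine ⟨√(∑ i, ‖y i‖ ^ 2), ?_⟩
    rintro _ ⟨ψ, rfl⟩
    refine (PiLp.norm_eq_of_L2 _).trans_le ?_
    refine Real.sqrt_le_sqrt (Finset.sum_le_sum fun i _ => ?_)
    gcongr
    exact (ψ.1.le_of_opNorm_le ψ.2 _).trans_eq (one_mul _)
  have h := le_ciSup hb φ
  calc ∑ i, ‖φ.1 (y i)‖ ^ 2 = ‖WithLp.toLp 2 (fun i => φ.1 (y i))‖ ^ 2 := by
        rw [PiLp.norm_sq_eq_of_L2]
    _ ≤ weakNorm 2 y ^ 2 := by gcongr; exact h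

theorem weakNorm_nonneg (q : ENNReal) [Fact (1 ≤ q)] {n : ℕ} (y : Fin n → StrongDual ℂ F) :
    0 ≤ weakNorm q y := Real.iSup_nonneg fun _ => norm_nonneg _

theorem weakNorm_two_le {n : ℕ} (y : Fin n → StrongDual ℂ F) {M : ℝ} (hM : 0 ≤ M)
    (h : ∀ φ : StrongDual ℂ (StrongDual ℂ F), ‖φ‖ ≤ 1 → ∑ i, ‖φ (y i)‖ ^ 2 ≤ M ^ 2) :
    weakNorm 2 y ≤ M := by
  refine Real.iSup_le (fun φ => ?_) hM
  refine (pow_le_pow_iff_left₀ (norm_nonneg _) hM two_ne_zero).mp ?_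
  rw [PiLp.norm_sq_eq_of_L2]
  exact h φ.1 φ.2

end WeakNorm

/-! ### Pietsch domination -/

variable {E F : Type*} [NormedAddCommGroup E] [NormedSpace ℂ E]
  [NormedAddCommGroup F] [NormedSpace ℂ F]

/-- The cone of functions `φ ↦ ∑ i, (C ^ 2 * ‖φ (y i)‖ ^ 2 - ‖y i (f (x i))‖ ^ 2)`. -/
noncomputable def dominationCone (U : Set E) (f : E → F) (C : ℝ) :
    ConvexCone ℝ ({φ : StrongDual ℂ (StrongDual ℂ F) // ‖φ‖ ≤ 1} →ᵇ ℝ) where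
  carrier := {s | ∃ (n : ℕ) (x : Fin n → E) (y : Fin n → StrongDual ℂ F), (∀ i, x i ∈ U) ∧
    s = ∑ i, (C ^ 2 • sqEval (y i) - ‖y i (f (x i))‖ ^ 2 • 1)}
  smul_mem' := by
    rintro t ht _ ⟨n, x, y, hx, rfl⟩
    -- Both terms are quadratic in y.
    refine ⟨n, x, fun i => (√t : ℂ) • y i, hx, ?_⟩
    ext φ
    simp only [BoundedContinuousFunction.coe_smul, BoundedContinuousFunction.coe_sum,
      Finset.sum_apply, BoundedContinuousFunction.coe_sub, Pi.sub_apply, sqEval_apply,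
      BoundedContinuousFunction.coe_one, Pi.one_apply, smul_eq_mul, Finset.mul_sum, map_smul,
      norm_mul, _root_.smul_apply, mul_pow, Complex.norm_real, Real.norm_eq_abs, sq_abs,
      Real.sq_sqrt ht.le]
    exact Finset.sum_congr rfl fun i _ => by ring
  add_mem' := by
    rintro _ ⟨n, x, y, hx, rfl⟩ _ ⟨m, x', y', hx', rfl⟩
    refine ⟨n + m, Fin.append x x', Fin.append y y', fun i => ?_, ?_⟩
    · refine Fin.addCases (fun i => ?_) (fun i => ?_) i
      · simpa using hx i
      · simpa using hx' i
    · simp only [Fin.sum_univ_add, Fin.append_left, Fin.append_right]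

/-- Pietsch domination for Cohen strongly `2`-summing mappings, with the integral with respect to
a probability measure on the unit ball of the bidual replaced by a positive functional. -/
theorem IsCohenStronglySumming.exists_domination {U : Set E} {f : E → F}
    (hf : IsCohenStronglySumming 2 U f) :
    ∃ (L : StrongDual ℝ ({φ : StrongDual ℂ (StrongDual ℂ F) // ‖φ‖ ≤ 1} →ᵇ ℝ)) (C : ℝ),
      0 ≤ C ∧ L 1 = 1 ∧ (∀ v, (∀ k, 0 ≤ v k) → 0 ≤ L v) ∧
      ∀ x ∈ U, ∀ y : StrongDual ℂ F, ‖y (f x)‖ ^ 2 ≤ C ^ 2 * L (sqEval y) := by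
  obtain ⟨-, C₀, hC₀, hC⟩ := hf
  rw [conjExponent_two] at hC
  -- Positive, to allow division.
  let C := C₀ + 1
  have hCpos : 0 < C := by positivity
  obtain ⟨L, hL1, hLp, hLS⟩ := exists_mean_nonneg (dominationCone U f C)
    ⟨0, Fin.elim0, Fin.elim0, fun i => i.elim0, by simp⟩ (by
      rintro _ ⟨n, x, y, hx, rfl⟩ ε hε
      by_contra! hneg
      -- These weights turn the summing inequality into S ≤ √S √(S - ε) < S.
      let l : Fin n → ℂ := fun i => (‖y i (f (x i))‖ : ℂ)
      let S := ∑ i, ‖y i (f (x i))‖ ^ 2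
      have hneg' : ∀ φ : StrongDual ℂ (StrongDual ℂ F), ‖φ‖ ≤ 1 →
          C ^ 2 * ∑ i, ‖φ (y i)‖ ^ 2 ≤ S - ε := by
        intro φ hφ
        have := hneg ⟨φ, hφ⟩
        simp only [BoundedContinuousFunction.coe_smul, BoundedContinuousFunction.coe_sum,
          Finset.sum_apply, BoundedContinuousFunction.coe_sub, Pi.sub_apply, sqEval_apply,
          BoundedContinuousFunction.coe_one, Pi.one_apply, smul_eq_mul, mul_one,
          Finset.sum_sub_distrib, ← Finset.mul_sum] at this
        linarith
      have hSε : 0 ≤ S - ε := by simpa using hneg' 0 (ContinuousLinearMap.opNorm_zero.trans_le zero_le_one)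
      have hS : 0 < S := by linarith
      have hw : weakNorm 2 y ≤ √(S - ε) / C := weakNorm_two_le y (by positivity) fun φ hφ => by
        rw [div_pow, Real.sq_sqrt hSε, le_div_iff₀ (by positivity), mul_comm]
        exact hneg' φ hφ
      have hl : ‖WithLp.toLp 2 l‖ = √S := by simp [PiLp.norm_eq_of_L2, l, S]
      have h1 : S ≤ C₀ * √S * weakNorm 2 y := by
        have := hC n l x y hx
        rw [hl] at this
        refine le_of_eq_of_le ?_ this
        exact Finset.sum_congr rfl fun i _ => by simp [l, sq]
      have h2 : S ≤ C * √S * (√(S - ε) / C) := by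
        refine h1.trans ?_
        gcongr
        · exact weakNorm_nonneg 2 y
        · exact (lt_add_one C₀).le
      have h3 : C * √S * (√(S - ε) / C) = √S * √(S - ε) := by field_simp
      have h4 : √(S - ε) < √S := Real.sqrt_lt_sqrt hSε (by linarith)
      have h5 : √S * √S = S := Real.mul_self_sqrt hS.le
      nlinarith [Real.sqrt_pos.mpr hS])
  refine ⟨L, C, hCpos.le, hL1, hLp, fun x hx y => ?_⟩
  have := hLS _ ⟨1, fun _ => x, fun _ => y, fun _ => hx, rfl⟩
  simp only [Finset.univ_unique, Finset.sum_const, Finset.card_singleton, one_smul, map_sub,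
    map_smul, hL1, smul_eq_mul, mul_one] at this
  linarith

/-! ### Reflexivity and the factorization -/

/-- A reflexive space is isometric to its bidual. -/
noncomputable def IsReflexive.equiv (hF : IsReflexive F) :
    F ≃ₗᵢ[ℂ] StrongDual ℂ (StrongDual ℂ F) :=
  LinearIsometryEquiv.ofSurjective (NormedSpace.inclusionInDoubleDualLi ℂ) hF

theorem IsReflexive.apply_equiv_symm (hF : IsReflexive F) (y : StrongDual ℂ F)
    (φ : StrongDual ℂ (StrongDual ℂ F)) : y (hF.equiv.symm φ) = φ y := by
  conv_rhs => rw [← hF.equiv.apply_symm_apply φ]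
  rfl

end CohenSumming

open CohenSumming in
theorem mainTheorem10 {E : Type u} {F : Type v}
    [NormedAddCommGroup E] [NormedSpace ℂ E] [CompleteSpace E]
    [NormedAddCommGroup F] [NormedSpace ℂ F] [CompleteSpace F]
    (hF : CohenSumming.IsReflexive F)
    (U : Set E) (hU : IsOpen U) (f : E → F)
    (hf : CohenSumming.IsCohenStronglySumming 2 U f) :
    ∃ (H : Type v) (_ : NormedAddCommGroup H) (_ : InnerProductSpace ℂ H) (_ : CompleteSpace H)
      (T : H →L[ℂ] F) (g : E → H),
      CohenSumming.IsStronglySumming 2 T ∧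
      CohenSumming.IsBoundedHolomorphic U g ∧
      ∀ x ∈ U, f x = T (g x) := by
  obtain ⟨L, C, hC, hL1, hLp, hdom⟩ := hf.exists_domination
  obtain ⟨H, _, _, _, j, hj, hjn⟩ := exists_hilbert_of_core (coreOfMean L hLp)
  simp only [re_coreOfMean_inner_self] at hjn
  have hmono : ∀ v w, (∀ k, v k ≤ w k) → L v ≤ L w := fun v w h => by
    have := hLp (w - v) fun k => sub_nonneg.mpr (h k)
    rwa [map_sub, sub_nonneg] at this
  have hconst : ∀ v (M : ℝ), (∀ k, v k ≤ M) → L v ≤ M := fun v M h => by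
    have := hmono v (M • 1) fun k => by simpa using h k
    simpa [hL1] using this
  have hjle : ∀ y, ‖j y‖ ≤ 1 * ‖y‖ := fun y => by
    rw [one_mul]
    refine (pow_le_pow_iff_left₀ (norm_nonneg _) (norm_nonneg _) two_ne_zero).mp ?_
    rw [hjn]
    refine hconst _ _ fun φ => ?_
    rw [sqEval_apply]
    gcongr
    exact (φ.1.le_of_opNorm_le φ.2 y).trans_eq (one_mul _)
  let J : StrongDual ℂ F →L[ℂ] H := j.mkContinuous 1 hjle
  let ℓ : E → StrongDual ℂ F →ₗ[ℂ] ℂ := fun x =>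
    (NormedSpace.inclusionInDoubleDual ℂ F (f x)).toLinearMap
  have hℓ : ∀ x ∈ U, ∀ y, ‖ℓ x y‖ ≤ C * ‖j y‖ := fun x hx y => by
    refine (pow_le_pow_iff_left₀ (norm_nonneg _) (by positivity) two_ne_zero).mp ?_
    rw [mul_pow, hjn]
    exact hdom x hx y
  let g : E → StrongDual ℂ H := fun x => (ℓ x).extendOfNorm j
  have hgj : ∀ x ∈ U, ∀ y, g x (j y) = y (f x) := fun x hx y =>
    LinearMap.extendOfNorm_eq hj ⟨C, hℓ x hx⟩ y
  have hgC : ∀ x ∈ U, ‖g x‖ ≤ C := fun x hx =>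
    LinearMap.opNorm_extendOfNorm_le hj hC (hℓ x hx)
  -- The adjoint h ↦ h ∘ J, followed by F** ≅ F.
  let T : StrongDual ℂ H →L[ℂ] F :=
    hF.equiv.symm.toContinuousLinearEquiv.toContinuousLinearMap.comp
      ((ContinuousLinearMap.compL ℂ (StrongDual ℂ F) H ℂ).flip J)
  have hT : ∀ (h : StrongDual ℂ H) (y : StrongDual ℂ F), y (T h) = h (j y) := fun h y =>
    hF.apply_equiv_symm y (h.comp J)
  refine ⟨StrongDual ℂ H, inferInstance, innerProductSpaceDual H, inferInstance, T, g,
    ⟨1, zero_le_one, fun n h y => ?_⟩, ⟨?_, ?_⟩, fun x hx => ?_⟩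
  · rw [conjExponent_two]
    have h1 : ∑ i, ‖j (y i)‖ ^ 2 ≤ weakNorm 2 y ^ 2 := by
      simp only [hjn, ← map_sum]
      refine hconst _ _ fun φ => ?_
      simpa using sum_norm_sq_le_weakNorm_sq y φ
    calc ∑ i, ‖y i (T (h i))‖ ≤ ∑ i, ‖h i‖ * ‖j (y i)‖ := Finset.sum_le_sum fun i _ => by
          rw [hT]; exact (h i).le_opNorm _
      _ ≤ √(∑ i, ‖h i‖ ^ 2) * √(∑ i, ‖j (y i)‖ ^ 2) :=
          Real.sum_mul_le_sqrt_mul_sqrt _ _ _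
      _ ≤ √(∑ i, ‖h i‖ ^ 2) * weakNorm 2 y := by
          gcongr
          exact Real.sqrt_le_iff.mpr ⟨weakNorm_nonneg 2 y, h1⟩
      _ = 1 * ‖WithLp.toLp 2 h‖ * weakNorm 2 y := by rw [one_mul, PiLp.norm_eq_of_L2]
  · refine differentiableOn_of_denseRange hU j hj g hgC fun y => ?_
    exact (y.differentiable.comp_differentiableOn hf.1).congr fun x hx => hgj x hx y
  · refine isBounded_iff_forall_norm_le.mpr ⟨C, ?_⟩
    rintro _ ⟨x, hx, rfl⟩
    exact hgC x hx
  · refine SeparatingDual.eq_iff_forall_dual_eq (R := ℂ) |>.mpr fun y => ?_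
    rw [hT, hgj x hx]
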